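/- Let $n\ge 3$. There exists a Delone set $X\subset\mathbb Z^n\subset\mathbb R^n$ with the following properties. (1) $X$ is aperiodic: $X+t=X$ with $t\in\mathbb R^n$ only for $t=0$. (2) $X$ is repetitive: for every $T>0$ there is $M>0$ such that for every closed ball $B$ of radius $M$ and every $x\in X$ there is $y\in X\cap B$ with $(X\cap B(y;T))-y=(X\cap B(x;T))-x$. (3) $X$ is a Meyer set: $X$ and $X-X$ are both Delone sets. (4) $\displaystyle\liminf_{T\to\infty}\frac{N_X(T)}{T^{\lceil (n+1)/2\rceil+\varepsilon}}=0$ for every $\varepsilon>0$. (5) $\displaystyle\limsup_{T\to\infty}\frac{N_X(T)}{T^{n}}>0$. (6) $X$ arises from $\mathbb Z^n$ by removing a hierarchy of affine subspaces of dimension $k=\lfloor (n-1)/2\rfloor$ (lines if $n=3$). That is, there are systems $F_0\supseteq F_1\supseteq F_2\supseteq\cdots$ with $\bigcap_j F_j=\emptyset$ such that: the elements of $F_0$ are pairwise disjoint $k$-dimensional affine subspaces of $\mathbb R^n$, each containing an integer point and parallel to $k$ of the coordinate axes; for each $j$ there is an integer $q_j\geq 1$ such that $F_j$ is invariant under translation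 by $q_j\mathbb Z^n$; for every $D$ there is a $j$ such that any two distinct elements of $F_j$ are at distance at least $D$; and $$X=\mathbb Z^n\setminus\bigcup_{j\ge 0}\ \bigcup_{L\in F_{2j}\setminus F_{2j+1}}L .$$ Here $B(x;T)$ is the closed Euclidean ball of radius $T$ about $x$, $N_X(T)$ is the number of distinct sets $(X\cap B(x;T))-x$ with $x\in X$, and a Delone set is a subset of $\mathbb R^n$ for which there are $r,R>0$ such that each open ball of radius $r$ contains at most one of its points and each closed ball of radius $R$ contains at least one. -/

import Mathlib

open Filter Set
open scoped Pointwise ENNReal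

/-- `X` is a Delone set: uniformly discrete and relatively dense for some pair of radii. -/
def IsDelone {n : ℕ} (X : Set (EuclideanSpace ℝ (Fin n))) : Prop :=
  ∃ D : Delone.DeloneSet (EuclideanSpace ℝ (Fin n)), D.carrier = X

/-- A Meyer set is a Delone set `X` whose difference set `X - X` is a Delone set. -/
def IsMeyer {n : ℕ} (X : Set (EuclideanSpace ℝ (Fin n))) : Prop :=
  IsDelone X ∧ IsDelone (X - X)

/-- The translation symmetries `Λ_X` of `X`. -/
def periodSet {n : ℕ} (X : Set (EuclideanSpace ℝ (Fin n))) :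
    Set (EuclideanSpace ℝ (Fin n)) :=
  {t | t +ᵥ X = X}

/-- `X` is aperiodic: its only translation symmetry is `0`. -/
def IsAperiodic {n : ℕ} (X : Set (EuclideanSpace ℝ (Fin n))) : Prop :=
  periodSet X = {0}

/-- The `T`-patch of `X` centered at `x`, translated so that its center is the origin. -/
def centeredPatch {n : ℕ} (X : Set (EuclideanSpace ℝ (Fin n)))
    (x : EuclideanSpace ℝ (Fin n)) (T : ℝ) : Set (EuclideanSpace ℝ (Fin n)) :=
  (fun y => y - x) '' (X ∩ Metric.closedBall x T)

/-- The `T`-atlas of `X`: all its `T`-patches (centered at points of `X`), translated to the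
origin. -/
def patchAtlas {n : ℕ} (X : Set (EuclideanSpace ℝ (Fin n))) (T : ℝ) :
    Set (Set (EuclideanSpace ℝ (Fin n))) :=
  {P | ∃ x ∈ X, P = centeredPatch X x T}

/-- The patch-counting function `N_X(T)`: the number of `T`-patches of `X` up to translation
(possibly `∞`), regarded as an extended nonnegative real. -/
noncomputable def patchCount {n : ℕ} (X : Set (EuclideanSpace ℝ (Fin n))) (T : ℝ) : ℝ≥0∞ :=
  ((patchAtlas X T).encard : ℝ≥0∞)

/-- The Delone set `X` is repetitive: for each `T > 0` there is `M > 0` such that every closed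
ball of radius `M` contains, for each `T`-patch of `X`, the center of a translate of it. -/
def IsRepetitive {n : ℕ} (X : Set (EuclideanSpace ℝ (Fin n))) : Prop :=
  IsDelone X ∧
    ∀ T : ℝ, 0 < T → ∃ M : ℝ, 0 < M ∧ ∀ c : EuclideanSpace ℝ (Fin n), ∀ x ∈ X,
      ∃ y ∈ X ∩ Metric.closedBall c M, centeredPatch X y T = centeredPatch X x T

/-- The lattice `ℤⁿ` of integer points in `ℝⁿ`. -/
def integerPoints (n : ℕ) : Set (EuclideanSpace ℝ (Fin n)) :=
  {x | ∀ i, ∃ m : ℤ, x i = (m : ℝ)}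

/-- `L` is a `k`-dimensional affine subspace through an integer point and parallel to `k`
of the coordinate axes: the coordinates in a set `S` of size `k` are free, the others are fixed
integers. -/
def IsCoordinateFlat {n : ℕ} (k : ℕ) (L : Set (EuclideanSpace ℝ (Fin n))) : Prop :=
  ∃ S : Finset (Fin n), S.card = k ∧
    ∃ p : Fin n → ℤ, L = {x | ∀ i, i ∉ S → x i = (p i : ℝ)}

/-- A hierarchy of systems of non-intersecting `k`-dimensional coordinate flats: decreasing
systems `F 0 ⊇ F 1 ⊇ F 2 ⊇ ⋯` with no flat common to all of them, each repeated periodically in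
all coordinate directions, with arbitrarily large distances between the flats of one system. -/
structure IsFlatHierarchy {n : ℕ} (k : ℕ)
    (F : ℕ → Set (Set (EuclideanSpace ℝ (Fin n)))) : Prop where
  flat : ∀ L ∈ F 0, IsCoordinateFlat k L
  disjoint : ∀ L ∈ F 0, ∀ L' ∈ F 0, L ≠ L' → Disjoint L L'
  nested : ∀ j, F (j + 1) ⊆ F j
  vanishing : ∀ L, ∃ j, L ∉ F j
  periodic : ∀ j, ∃ q : ℕ, 0 < q ∧
    ∀ v ∈ integerPoints n, ∀ L ∈ F j, (((q : ℝ) • v) +ᵥ L) ∈ F j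
  separated : ∀ D : ℝ, ∃ j, ∀ L ∈ F j, ∀ L' ∈ F j, L ≠ L' →
    ∀ x ∈ L, ∀ y ∈ L', D ≤ dist x y

/-- What remains of `ℤⁿ` when the flats of `F 0` are removed, those of `F 1` put back, those
of `F 2` removed again, and so on. -/
def hierarchicalRemoval {n : ℕ} (F : ℕ → Set (Set (EuclideanSpace ℝ (Fin n)))) :
    Set (EuclideanSpace ℝ (Fin n)) :=
  {x | x ∈ integerPoints n ∧ ∀ j, ∀ L ∈ F (2 * j) \ F (2 * j + 1), x ∉ L}

/-!
# An aperiodic repetitive Meyer set of oscillating patch complexity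

Let `S true` and `S false` be disjoint sets of `k = ⌊(n - 1) / 2⌋` coordinates, both avoiding a
coordinate `z`, and let `q j = scale j` be the periods. The `j`-th system consists of the flats
with free coordinates `S σ` whose fixed coordinates `p i` satisfy `q j ∣ 3 * p i ± 1`, the sign
being determined by `σ`. In other words, the fixed coordinates are congruent to the `2`-adic
integer `∓1/3`. This makes the systems nested, it leaves no flat in all of them since `1/3` is not
an integer, and it keeps distinct flats of one system about `q j / 3` apart: the differences of
their common fixed coordinates are `0` or `±2/3` modulo `q j` (`OnFlat.eq_of_close`). An integer
point on no flat survives, and a point on a flat survives if and only if the last system with a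
flat through it, its level, is odd (`mem_survivors_iff_odd`).

*Repetitivity* (`exists_patch_eq_near`). If `q j` is large compared with the radius, a patch meets
at most one flat of the `j`-th system, and it is determined by its centre modulo `q j`, by that flat
and by the parity of the level of that flat. Flats of levels `j` and `j + 1` are relatively dense
(`exists_level_near`).

*Many patches* (`modEq_of_patch_eq`). A patch of radius `2 * n * q j` meets flats of level exactly
`j` in both directions. They are recognisable as the flats of the system `j - 1` with the
wrong status, and as every coordinate is fixed by one of the two directions, they determine the
centre modulo `q j`, by induction on `j`. So there are at least `(q j / q 0) ^ n` patches. The same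
lemma, applied for all `j`, shows that there are no periods.

*Few patches* (`patchCount_le`). At the radius `N = q j ^ (j + 2) = q (j + 1) / q j` with `j` large,
a patch meets at most one flat of the system `j + 1`. It is determined by its centre modulo `q j`
and by the position of that flat, if the status of the flat is not that of level `j`. This gives
`O(q j ^ n * N ^ (n - k))` patches, and `q j ^ n` is smaller than any given positive power of `N`
for large `j`.
-/

variable {n : ℕ} {S : Bool → Finset (Fin n)} {z : Fin n}

/-! ### The arithmetic of the flat systems -/

/-- The period of the `j`-th system of flats. The choice makes each period a growing power of the
previous one, and keeps all of them coprime to `3`. -/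
def scale (j : ℕ) : ℕ := 2 ^ (j + 2).factorial

lemma scale_zero : scale 0 = 4 := rfl

lemma scale_pos (j : ℕ) : 0 < scale j := by unfold scale; positivity

lemma scale_succ (j : ℕ) : scale (j + 1) = scale j ^ (j + 3) := by
  unfold scale
  rw [← pow_mul, show j + 1 + 2 = (j + 2) + 1 by ring, Nat.factorial_succ, mul_comm]

lemma scale_dvd_scale {i j : ℕ} (h : i ≤ j) : scale i ∣ scale j :=
  pow_dvd_pow 2 (Nat.factorial_le (by omega))

lemma scale_mono {i j : ℕ} (h : i ≤ j) : scale i ≤ scale j :=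
  Nat.le_of_dvd (scale_pos j) (scale_dvd_scale h)

lemma four_le_scale (j : ℕ) : 4 ≤ scale j := scale_zero ▸ scale_mono (Nat.zero_le j)

lemma lt_scale (j : ℕ) : j < scale j :=
  calc j < j + 2 := by omega
    _ ≤ (j + 2).factorial := Nat.self_le_factorial _
    _ < scale j := Nat.lt_two_pow_self

lemma four_mul_scale_le_scale_succ (j : ℕ) : 4 * scale j ≤ scale (j + 1) := by
  rw [scale_succ, show j + 3 = (j + 1) + 1 + 1 by ring, pow_succ]
  gcongr
  calc 4 ≤ scale j := four_le_scale j
    _ ≤ scale j ^ (j + 1 + 1) := Nat.le_self_pow (by omega) _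

lemma scale_isCoprime_three (j : ℕ) : IsCoprime (scale j : ℤ) 3 := by
  have : Nat.Coprime (scale j) 3 := Nat.Coprime.pow_left _ (by norm_num)
  exact_mod_cast this.isCoprime

/-- The sign `±1` attached to each of the two directions of flats. -/
def dirSign (σ : Bool) : ℤ := if σ then 1 else -1

lemma eq_of_three_dvd_dirSign_sub {σ τ : Bool} (h : (3 : ℤ) ∣ dirSign σ - dirSign τ) : σ = τ := by
  revert h; revert σ τ; decide

lemma abs_dirSign_sub_le (σ τ : Bool) : |dirSign σ - dirSign τ| ≤ 2 := by
  revert σ τ; decide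

/-- `S true` and `S false` are disjoint sets of coordinates (every coordinate is missing from one
of them), and both avoid `z`. -/
structure IsDirectionPair (S : Bool → Finset (Fin n)) (z : Fin n) : Prop where
  notMem : ∀ σ, z ∉ S σ
  exists_notMem : ∀ i, ∃ σ, i ∉ S σ

/-- The integer point `x` lies on a flat of the `j`-th system whose free coordinates are `S σ`.
The fixed coordinates are required to be congruent to `∓1/3` modulo `scale j`; as `∓1/3` is a
`2`-adic integer but not an integer, no point lies on flats of all systems. -/
def OnFlat (S : Bool → Finset (Fin n)) (j : ℕ) (σ : Bool) (x : Fin n → ℤ) : Prop :=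
  ∀ i, i ∉ S σ → (scale j : ℤ) ∣ 3 * x i + dirSign σ

lemma OnFlat.anti {i j : ℕ} {σ : Bool} {x : Fin n → ℤ} (h : OnFlat S j σ x) (hij : i ≤ j) :
    OnFlat S i σ x := fun a ha =>
  (Int.natCast_dvd_natCast.2 (scale_dvd_scale hij)).trans (h a ha)

lemma onFlat_congr_off {j : ℕ} {σ : Bool} {x y : Fin n → ℤ} (h : ∀ i, i ∉ S σ → x i = y i) :
    OnFlat S j σ x ↔ OnFlat S j σ y :=
  forall₂_congr fun i hi => by rw [h i hi]

lemma onFlat_congr_mod {i j : ℕ} {σ : Bool} {x y : Fin n → ℤ}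
    (h : ∀ a, (scale j : ℤ) ∣ x a - y a) (hij : i ≤ j) : OnFlat S i σ x ↔ OnFlat S i σ y := by
  refine forall₂_congr fun a _ => ?_
  have h1 : (scale i : ℤ) ∣ 3 * (x a - y a) :=
    ((Int.natCast_dvd_natCast.2 (scale_dvd_scale hij)).trans (h a)).mul_left 3
  rw [show 3 * x a + dirSign σ = 3 * (x a - y a) + (3 * y a + dirSign σ) by ring,
    dvd_add_right h1]

/-- Two flats of the `j`-th system, given by points on them, coincide as soon as their
common fixed coordinates are less than about `scale j / 3` apart. -/
lemma OnFlat.eq_of_close (hS : IsDirectionPair S z) {j : ℕ} {σ τ : Bool} {x y : Fin n → ℤ}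
    (hx : OnFlat S j σ x) (hy : OnFlat S j τ y)
    (hxy : ∀ i, i ∉ S σ → i ∉ S τ → 3 * |x i - y i| + 2 < scale j) :
    σ = τ ∧ ∀ i, i ∉ S σ → x i = y i := by
  have key : ∀ i, i ∉ S σ → i ∉ S τ → 3 * (x i - y i) + (dirSign σ - dirSign τ) = 0 := by
    intro i h1 h2
    have hd : (scale j : ℤ) ∣ 3 * (x i - y i) + (dirSign σ - dirSign τ) := by
      have := dvd_sub (hx i h1) (hy i h2)
      rwa [show 3 * x i + dirSign σ - (3 * y i + dirSign τ) =
        3 * (x i - y i) + (dirSign σ - dirSign τ) by ring] at this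
    refine Int.eq_zero_of_abs_lt_dvd hd ?_
    have h3 := abs_add_le (3 * (x i - y i)) (dirSign σ - dirSign τ)
    rw [abs_mul, abs_of_pos (by norm_num : (0 : ℤ) < 3)] at h3
    have := hxy i h1 h2
    have := abs_dirSign_sub_le σ τ
    omega
  have hst : σ = τ := by
    apply eq_of_three_dvd_dirSign_sub
    have := key z (hS.notMem σ) (hS.notMem τ)
    omega
  subst hst
  refine ⟨rfl, fun i hi => ?_⟩
  have := key i hi hi
  omega

lemma OnFlat.dir_unique (hS : IsDirectionPair S z) {i j : ℕ} {σ τ : Bool} {x : Fin n → ℤ}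
    (hx : OnFlat S i σ x) (hy : OnFlat S j τ x) : σ = τ := by
  refine ((hx.anti i.zero_le).eq_of_close hS (hy.anti j.zero_le) fun a _ _ => ?_).1
  simp [scale_zero]

lemma exists_not_onFlat (hS : IsDirectionPair S z) (σ : Bool) (x : Fin n → ℤ) :
    ∃ j, ¬ OnFlat S j σ x := by
  refine ⟨(3 * x z + dirSign σ).natAbs, fun h => ?_⟩
  have h1 := Int.natAbs_dvd_natAbs.2 (h z (hS.notMem σ))
  rw [Int.natAbs_natCast] at h1
  have h0 : (3 * x z + dirSign σ).natAbs ≠ 0 := by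
    cases σ <;> simp [dirSign] <;> omega
  exact absurd (Nat.le_of_dvd (Nat.pos_of_ne_zero h0) h1) (not_le.2 (lt_scale _))

/-- A point on a flat of the `j`-th system has a level: the last system with a flat
through it. -/
lemma OnFlat.exists_level (hS : IsDirectionPair S z) {j : ℕ} {σ : Bool} {x : Fin n → ℤ}
    (h : OnFlat S j σ x) : ∃ m, j ≤ m ∧ OnFlat S m σ x ∧ ¬ OnFlat S (m + 1) σ x := by
  by_contra! hc
  obtain ⟨i, hi⟩ := exists_not_onFlat hS σ x
  have : ∀ m, j ≤ m → OnFlat S m σ x := fun m hm => Nat.le_induction h hc m hm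
  exact hi ((this _ (le_max_left j i)).anti (le_max_right j i))

/-- The integer points that survive the successive removals and reinsertions of flats. -/
def survivors (S : Bool → Finset (Fin n)) : Set (Fin n → ℤ) :=
  {x | ∀ j σ, OnFlat S (2 * j) σ x → OnFlat S (2 * j + 1) σ x}

lemma mem_survivors_iff_odd (hS : IsDirectionPair S z) {m : ℕ} {σ : Bool} {x : Fin n → ℤ}
    (h : OnFlat S m σ x) (h' : ¬ OnFlat S (m + 1) σ x) : x ∈ survivors S ↔ Odd m := by
  constructor
  · intro hx
    by_contra hm
    obtain ⟨j, rfl⟩ := (Nat.not_odd_iff_even.1 hm).exists_two_nsmul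
    exact h' (hx j σ h)
  · rintro ⟨a, rfl⟩ j τ hj
    obtain rfl := h.dir_unique hS hj
    refine h.anti ?_
    by_contra hlt
    exact h' (hj.anti (by omega))

lemma mem_survivors_congr_off (hS : IsDirectionPair S z) {σ : Bool} {x y : Fin n → ℤ} {j : ℕ}
    (hx : OnFlat S j σ x) (h : ∀ i, i ∉ S σ → x i = y i) :
    x ∈ survivors S ↔ y ∈ survivors S := by
  obtain ⟨m, -, h1, h2⟩ := hx.exists_level hS
  rw [mem_survivors_iff_odd hS h1 h2, mem_survivors_iff_odd hS
    ((onFlat_congr_off h).1 h1) (mt (onFlat_congr_off h).2 h2)]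

/-- Off the flats of the `j`-th system, the surviving points are determined by residues modulo
`scale j`. -/
lemma mem_survivors_congr_mod {j : ℕ} {x y : Fin n → ℤ} (hxy : ∀ a, (scale j : ℤ) ∣ x a - y a)
    (hx : ∀ σ, ¬ OnFlat S j σ x) : x ∈ survivors S ↔ y ∈ survivors S := by
  have key : ∀ m σ, OnFlat S m σ x ↔ OnFlat S m σ y := by
    intro m σ
    rcases le_total m j with h | h
    · exact onFlat_congr_mod hxy h
    · exact iff_of_false (fun h1 => hx σ (h1.anti h))
        fun h1 => hx σ ((onFlat_congr_mod hxy le_rfl).2 (h1.anti h))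
  simp only [survivors, mem_ofPred_eq, key]

lemma mem_survivors_of_scale_zero_dvd (hS : IsDirectionPair S z) {x : Fin n → ℤ}
    (hx : ∀ i, (4 : ℤ) ∣ x i) : x ∈ survivors S := by
  intro j σ h
  have h1 := h.anti (Nat.zero_le _) z (hS.notMem σ)
  rw [scale_zero] at h1
  have := hx z
  cases σ <;> simp [dirSign] at h1 <;> omega

lemma exists_modEq_near {q : ℤ} (hq : 0 < q) (a c : ℤ) : ∃ y, q ∣ y - a ∧ |y - c| ≤ q := by
  refine ⟨c + (a - c) % q, ?_, ?_⟩
  · have := Int.emod_add_mul_ediv (a - c) q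
    exact ⟨-((a - c) / q), by linarith⟩
  · rw [add_sub_cancel_left, abs_of_nonneg (Int.emod_nonneg _ hq.ne')]
    exact (Int.emod_lt_of_pos _ hq).le

/-- Points of any prescribed level and direction are relatively dense. -/
lemma exists_level_near (hS : IsDirectionPair S z) (j : ℕ) (σ : Bool) (c : Fin n → ℤ) :
    ∃ w : Fin n → ℤ, OnFlat S j σ w ∧ ¬ OnFlat S (j + 1) σ w ∧
      ∀ i, |w i - c i| ≤ 2 * scale j := by
  have hq : (0 : ℤ) < scale j := by exact_mod_cast scale_pos j
  obtain ⟨u, v, huv⟩ := scale_isCoprime_three j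
  -- `- dirSign σ * v` is a residue of `- dirSign σ / 3`
  choose w hw1 hw2 using fun i => exists_modEq_near hq (- dirSign σ * v) (c i)
  have hw : OnFlat S j σ w := by
    intro i _
    obtain ⟨t, ht⟩ := hw1 i
    refine ⟨3 * t + dirSign σ * u, ?_⟩
    have : w i = scale j * t - dirSign σ * v := by linarith
    rw [this]
    linear_combination (-dirSign σ) * huv
  by_cases h : OnFlat S (j + 1) σ w
  · refine ⟨fun i => w i + scale j, ?_, ?_, fun i => ?_⟩
    · intro i hi
      have := hw i hi
      simpa [mul_add, add_right_comm] using dvd_add this (Dvd.intro_left (3 : ℤ) rfl)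
    · intro h'
      have h1 := dvd_sub (h' z (hS.notMem σ)) (h z (hS.notMem σ))
      rw [show 3 * (w z + (scale j : ℤ)) + dirSign σ - (3 * w z + dirSign σ) = 3 * scale j by ring]
        at h1
      have h2 := Int.le_of_dvd (by positivity) h1
      have := four_mul_scale_le_scale_succ j
      omega
    · have := abs_le.1 (hw2 i)
      rw [abs_le]; constructor <;> linarith
  · exact ⟨w, hw, h, fun i => (hw2 i).trans (by linarith)⟩

/-- Patches of radius proportional to `scale j` determine residues modulo `scale j`, once residues
modulo `scale 0` are known: a flat of level exactly `j` shows up in the patch as a flat of the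
system `j - 1` that has the wrong status. -/
lemma modEq_of_patch_eq (hS : IsDirectionPair S z) {x y : Fin n → ℤ} (j : ℕ)
    (h0 : ∀ i, (4 : ℤ) ∣ x i - y i)
    (h : ∀ v : Fin n → ℤ, (∀ i, |v i| ≤ 2 * scale j) →
      (x + v ∈ survivors S ↔ y + v ∈ survivors S)) :
    ∀ i, (scale j : ℤ) ∣ x i - y i := by
  induction j with
  | zero => simpa [scale_zero] using h0
  | succ j ih =>
    have hle : scale j ≤ scale (j + 1) := scale_mono (Nat.le_succ j)
    have ih' := ih fun v hv => h v fun i => (hv i).trans (by omega)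
    intro i
    obtain ⟨σ, hσ⟩ := hS.exists_notMem i
    obtain ⟨w, hw1, hw2, hw3⟩ := exists_level_near hS (j + 1) σ x
    have hv := h (w - x) hw3
    rw [add_sub_cancel, mem_survivors_iff_odd hS hw1 hw2] at hv
    have hyj : OnFlat S j σ (y + (w - x)) := by
      refine (onFlat_congr_mod (x := w) (j := j) (fun a => ?_) le_rfl).1 (hw1.anti (Nat.le_succ j))
      rw [Pi.add_apply, Pi.sub_apply, show w a - (y a + (w a - x a)) = x a - y a by ring]
      exact ih' a
    have hyj' : OnFlat S (j + 1) σ (y + (w - x)) := by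
      by_contra hc
      rw [mem_survivors_iff_odd hS hyj hc, Nat.odd_add_one] at hv
      tauto
    have h1 := dvd_sub (hw1 i hσ) (hyj' i hσ)
    rw [Pi.add_apply, Pi.sub_apply, show 3 * w i + dirSign σ - (3 * (y i + (w i - x i)) + dirSign σ)
      = 3 * (x i - y i) by ring] at h1
    exact (scale_isCoprime_three (j + 1)).dvd_of_dvd_mul_left h1

/-- If flats of the `j`-th system are far apart, every patch recurs near every point. -/
lemma exists_patch_eq_near (hS : IsDirectionPair S z) {N : ℕ} {j : ℕ} (hj : 6 * N + 2 < scale j)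
    (x c : Fin n → ℤ) :
    ∃ y : Fin n → ℤ, (∀ i, |y i - c i| ≤ 2 * scale (j + 1)) ∧
      ∀ v : Fin n → ℤ, (∀ i, |v i| ≤ N) → (x + v ∈ survivors S ↔ y + v ∈ survivors S) := by
  classical
  have hq : (0 : ℤ) < scale j := by exact_mod_cast scale_pos j
  have hle : scale j ≤ scale (j + 1) := scale_mono (Nat.le_succ j)
  choose y hy1 hy2 using fun i => exists_modEq_near hq (x i) (c i)
  by_cases hflat : ∃ v : Fin n → ℤ, (∀ i, |v i| ≤ N) ∧ ∃ σ, OnFlat S j σ (x + v)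
  swap
  · push Not at hflat
    refine ⟨y, fun i => (hy2 i).trans (by omega), fun v hv => ?_⟩
    refine mem_survivors_congr_mod (j := j) (fun a => ?_) (hflat v hv)
    rw [Pi.add_apply, Pi.add_apply, add_sub_add_right_eq_sub, ← dvd_neg, neg_sub]
    exact hy1 a
  obtain ⟨v₀, hv₀, σ, hσ⟩ := hflat
  obtain ⟨m, hm, hm1, hm2⟩ := hσ.exists_level hS
  -- a level in `{j, j + 1}` of the right parity
  obtain ⟨m', hjm, hmj, hodd⟩ : ∃ m', j ≤ m' ∧ m' ≤ j + 1 ∧ (Odd m ↔ Odd m') := by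
    by_cases h : Odd m ↔ Odd j
    · exact ⟨j, le_rfl, Nat.le_succ j, h⟩
    · refine ⟨j + 1, Nat.le_succ j, le_rfl, ?_⟩
      rw [Nat.odd_add_one]; tauto
  obtain ⟨w, hw1, hw2, hw3⟩ := exists_level_near hS m' σ (c + v₀)
  have hle' : scale m' ≤ scale (j + 1) := scale_mono hmj
  -- the flat through `w` fixes the coordinates outside `S σ`, the others are free
  let y' : Fin n → ℤ := fun i => if i ∈ S σ then y i else w i - v₀ i
  have hoff : ∀ i, i ∉ S σ → w i = (y' + v₀) i := fun i hi => by simp [y', hi]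
  have hmod : ∀ i, (scale j : ℤ) ∣ x i - y' i := by
    intro i
    by_cases hi : i ∈ S σ
    · simp only [y', hi, if_true]
      rw [← dvd_neg, neg_sub]; exact hy1 i
    · have h1 := dvd_sub (hσ i hi) ((hw1.anti hjm) i hi)
      refine (scale_isCoprime_three j).dvd_of_dvd_mul_left ?_
      convert h1 using 1
      simp only [y', hi, if_false, Pi.add_apply]; ring
  refine ⟨y', fun i => ?_, fun v hv => ?_⟩
  · by_cases hi : i ∈ S σ
    · simp only [y', hi, if_true]
      exact (hy2 i).trans (by omega)
    · have := hw3 i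
      simp only [y', hi, if_false]
      rw [show w i - v₀ i - c i = w i - (c + v₀) i by simp only [Pi.add_apply]; ring]
      exact this.trans (by omega)
  · by_cases hflat : ∃ τ, OnFlat S j τ (x + v)
    · obtain ⟨τ, hτ⟩ := hflat
      obtain ⟨rfl, hoffv⟩ := hσ.eq_of_close hS hτ fun i _ _ => by
        have h1 := abs_le.1 (hv₀ i)
        have h2 := abs_le.1 (hv i)
        have : |(x + v₀) i - (x + v) i| ≤ 2 * N := by
          simp only [Pi.add_apply]
          rw [abs_le]; constructor <;> linarith
        omega
      have hoffv' : ∀ i, i ∉ S σ → v₀ i = v i := fun i hi => by simpa using hoffv i hi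
      rw [← mem_survivors_congr_off hS hσ hoffv, mem_survivors_iff_odd hS hm1 hm2, hodd,
        ← mem_survivors_iff_odd hS hw1 hw2]
      exact mem_survivors_congr_off hS hw1 fun i hi => by
        rw [hoff i hi, Pi.add_apply, Pi.add_apply, hoffv' i hi]
    · push Not at hflat
      exact mem_survivors_congr_mod (j := j) (fun a => by simpa using hmod a) hflat

/-! ### Integer points in Euclidean space -/

/-- An integer vector as a point of Euclidean space. -/
noncomputable def intPoint (x : Fin n → ℤ) : EuclideanSpace ℝ (Fin n) :=
  WithLp.toLp 2 fun i => (x i : ℝ)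

@[simp] lemma intPoint_apply (x : Fin n → ℤ) (i : Fin n) : intPoint x i = x i := rfl

lemma intPoint_injective : Function.Injective (intPoint (n := n)) := fun x y h => by
  ext i
  have := congrArg (fun v : EuclideanSpace ℝ (Fin n) => v i) h
  simpa using this

lemma intPoint_add (x y : Fin n → ℤ) : intPoint (x + y) = intPoint x + intPoint y := by
  ext i; simp

lemma intPoint_sub (x y : Fin n → ℤ) : intPoint (x - y) = intPoint x - intPoint y := by
  ext i; simp

lemma mem_integerPoints_iff {v : EuclideanSpace ℝ (Fin n)} :
    v ∈ integerPoints n ↔ ∃ x, intPoint x = v := by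
  constructor
  · intro h
    choose x hx using h
    exact ⟨x, by ext i; simp [hx]⟩
  · rintro ⟨x, rfl⟩ i
    exact ⟨x i, rfl⟩

lemma abs_coord_le_norm (v : EuclideanSpace ℝ (Fin n)) (i : Fin n) : |v i| ≤ ‖v‖ := by
  simpa using PiLp.norm_apply_le v i

lemma norm_le_of_abs_coord_le {v : EuclideanSpace ℝ (Fin n)} {C : ℝ} (hC : 0 ≤ C)
    (h : ∀ i, |v i| ≤ C) : ‖v‖ ≤ n * C := by
  rw [EuclideanSpace.norm_eq]
  refine Real.sqrt_le_iff.2 ⟨by positivity, ?_⟩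
  calc ∑ i, ‖v i‖ ^ 2 ≤ ∑ _i : Fin n, C ^ 2 := by
        gcongr with i; exact h i
    _ = n * C ^ 2 := by simp
    _ ≤ (n * C) ^ 2 := by
        rw [mul_pow]
        gcongr
        exact_mod_cast Nat.le_self_pow two_ne_zero n

lemma abs_le_of_norm_intPoint_le {v : Fin n → ℤ} {N : ℕ} (h : ‖intPoint v‖ ≤ N) (i : Fin n) :
    |v i| ≤ N := by
  have : |(v i : ℝ)| ≤ N := (abs_coord_le_norm (intPoint v) i).trans h
  exact_mod_cast this

lemma exists_intPoint_near (c : EuclideanSpace ℝ (Fin n)) :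
    ∃ x : Fin n → ℤ, ∀ i, |(x i : ℝ) - c i| ≤ 1 := by
  refine ⟨fun i => ⌊c i⌋, fun i => ?_⟩
  rw [abs_le]
  constructor <;> linarith [Int.floor_le (c i), Int.lt_floor_add_one (c i)]

/-- A set of integer points that contains a sublattice is a Delone set. -/
lemma isDelone_image_of_dvd {Y : Set (Fin n → ℤ)} {q : ℕ} (hq : 0 < q)
    (hY : ∀ x : Fin n → ℤ, (∀ i, (q : ℤ) ∣ x i) → x ∈ Y) : IsDelone (intPoint '' Y) := by
  refine ⟨{ carrier := intPoint '' Y, packingRadius := 1 / 2, packingRadius_pos := by norm_num,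
            isSeparated_packingRadius := ?_, coveringRadius := n * (q + 1) + 1,
            coveringRadius_pos := by positivity, isCover_coveringRadius := ?_ }, rfl⟩
  · rintro _ ⟨x, -, rfl⟩ _ ⟨y, -, rfl⟩ hxy
    obtain ⟨i, hi⟩ := Function.ne_iff.1 (ne_of_apply_ne intPoint hxy)
    have h1 : (1 : ℝ) ≤ dist (intPoint x) (intPoint y) := by
      rw [dist_eq_norm, ← intPoint_sub]
      refine le_trans ?_ (abs_coord_le_norm _ i)
      rw [intPoint_apply, ← Int.cast_abs]
      exact_mod_cast Int.one_le_abs (sub_ne_zero.2 hi)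
    rw [edist_nndist, ENNReal.coe_lt_coe, ← NNReal.coe_lt_coe, coe_nndist]
    refine lt_of_lt_of_le ?_ h1
    norm_num
  · intro c _
    obtain ⟨u, hu⟩ := exists_intPoint_near c
    choose y hy1 hy2 using fun i => exists_modEq_near (q := (q : ℤ)) (by exact_mod_cast hq) 0 (u i)
    refine ⟨intPoint y, ⟨y, hY y fun i => by simpa using hy1 i, rfl⟩, ?_⟩
    change edist c (intPoint y) ≤ _
    rw [edist_comm, edist_nndist, ENNReal.coe_le_coe, ← NNReal.coe_le_coe, coe_nndist, dist_eq_norm]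
    refine (norm_le_of_abs_coord_le (C := q + 1) (by positivity) fun i => ?_).trans ?_
    · have h1 : |(y i : ℝ) - u i| ≤ q := by exact_mod_cast hy2 i
      calc |(intPoint y - c) i| = |((y i : ℝ) - u i) + (u i - c i)| := by simp
        _ ≤ |(y i : ℝ) - u i| + |u i - c i| := abs_add_le _ _
        _ ≤ q + 1 := add_le_add h1 (hu i)
    · push_cast; linarith

/-! ### Patches of the surviving points -/

/-- The integer vectors pointing from `x` to surviving points at distance at most `T`. -/
def survivorPatch (S : Bool → Finset (Fin n)) (T : ℝ) (x : Fin n → ℤ) : Set (Fin n → ℤ) :=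
  {v | x + v ∈ survivors S ∧ ‖intPoint v‖ ≤ T}

lemma centeredPatch_intPoint (T : ℝ) (x : Fin n → ℤ) :
    centeredPatch (intPoint '' survivors S) (intPoint x) T = intPoint '' survivorPatch S T x := by
  ext p
  constructor
  · rintro ⟨_, ⟨⟨y, hy, rfl⟩, hd⟩, rfl⟩
    rw [Metric.mem_closedBall, dist_eq_norm, ← intPoint_sub] at hd
    exact ⟨y - x, ⟨by simpa using hy, hd⟩, intPoint_sub _ _⟩
  · rintro ⟨v, ⟨hv, hd⟩, rfl⟩
    refine ⟨intPoint (x + v), ⟨⟨_, hv, rfl⟩, ?_⟩, ?_⟩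
    · rwa [Metric.mem_closedBall, dist_eq_norm, ← intPoint_sub, add_sub_cancel_left]
    · change intPoint (x + v) - intPoint x = _
      rw [← intPoint_sub, add_sub_cancel_left]

lemma patchCount_intPoint (T : ℝ) : patchCount (intPoint '' survivors S) T =
    ((survivorPatch S T '' survivors S).encard : ℝ≥0∞) := by
  have : patchAtlas (intPoint '' survivors S) T =
      (fun P => intPoint '' P) '' (survivorPatch S T '' survivors S) := by
    ext P
    simp only [patchAtlas, image_image, mem_ofPred_eq, exists_mem_image, centeredPatch_intPoint]
    simp only [mem_image, eq_comm]
  rw [patchCount, this, (intPoint_injective.image_injective).encard_image]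

lemma modEq_of_survivorPatch_eq (hS : IsDirectionPair S z) {x y : Fin n → ℤ} {j : ℕ} {T : ℝ}
    (hT : n * (2 * scale j) ≤ T) (h0 : ∀ i, (4 : ℤ) ∣ x i - y i)
    (h : survivorPatch S T x = survivorPatch S T y) : ∀ i, (scale j : ℤ) ∣ x i - y i := by
  refine modEq_of_patch_eq hS j h0 fun v hv => ?_
  have hv' : ‖intPoint v‖ ≤ T := by
    refine (norm_le_of_abs_coord_le (C := 2 * scale j) (by positivity) fun i => ?_).trans hT
    change |(v i : ℝ)| ≤ 2 * scale j
    exact_mod_cast hv i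
  have := Set.ext_iff.1 h v
  simpa [survivorPatch, hv'] using this

/-! ### Aperiodicity, repetitivity and the Meyer property -/

lemma isDelone_survivors (hS : IsDirectionPair S z) : IsDelone (intPoint '' survivors S) :=
  isDelone_image_of_dvd (q := 4) (by norm_num) fun _ hx => mem_survivors_of_scale_zero_dvd hS hx

lemma isMeyer_survivors (hS : IsDirectionPair S z) : IsMeyer (intPoint '' survivors S) := by
  refine ⟨isDelone_survivors hS, ?_⟩
  have h : intPoint '' survivors S - intPoint '' survivors S =
      intPoint '' (survivors S - survivors S) := by
    ext p
    constructor
    · rintro ⟨_, ⟨x, hx, rfl⟩, _, ⟨y, hy, rfl⟩, rfl⟩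
      exact ⟨x - y, ⟨x, hx, y, hy, rfl⟩, intPoint_sub _ _⟩
    · rintro ⟨_, ⟨x, hx, y, hy, rfl⟩, rfl⟩
      exact ⟨_, ⟨x, hx, rfl⟩, _, ⟨y, hy, rfl⟩, (intPoint_sub _ _).symm⟩
  rw [h]
  refine isDelone_image_of_dvd (q := 4) (by norm_num) fun x hx => ?_
  exact ⟨x, mem_survivors_of_scale_zero_dvd hS hx, 0,
    mem_survivors_of_scale_zero_dvd hS fun i => dvd_zero _, sub_zero x⟩

lemma eq_zero_of_survivors_add (hS : IsDirectionPair S z) {t : Fin n → ℤ}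
    (ht : ∀ x, x + t ∈ survivors S ↔ x ∈ survivors S) : t = 0 := by
  -- `4 • t` is a period that is congruent to `0` modulo `scale 0`
  have h4 : ∀ x, x + 4 • t ∈ survivors S ↔ x ∈ survivors S := fun x => by
    rw [show x + 4 • t = x + t + t + t + t by ext i; simp; ring]
    simp only [ht]
  ext i
  by_contra hi
  have hd : ∀ j, (scale j : ℤ) ∣ (4 • t) i - (0 : Fin n → ℤ) i := fun j =>
    modEq_of_patch_eq hS j (fun i => by simp) (fun v _ => by rw [add_comm, h4, zero_add]) i
  have h1 := Int.natAbs_dvd_natAbs.2 (hd (4 * t i).natAbs)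
  simp only [Pi.smul_apply, Pi.zero_apply, sub_zero, Int.natAbs_natCast, nsmul_eq_mul,
    Nat.cast_ofNat] at h1
  have h2 : (4 * t i).natAbs ≠ 0 := by simpa using hi
  exact absurd (Nat.le_of_dvd (Nat.pos_of_ne_zero h2) h1) (not_le.2 (lt_scale _))

lemma isAperiodic_survivors (hS : IsDirectionPair S z) :
    IsAperiodic (intPoint '' survivors S) := by
  refine Set.Subset.antisymm (fun t ht => ?_) (by rintro _ rfl; simp [periodSet])
  have h0 : intPoint (0 : Fin n → ℤ) ∈ intPoint '' survivors S :=
    ⟨0, mem_survivors_of_scale_zero_dvd hS fun i => dvd_zero _, rfl⟩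
  have ht' : t +ᵥ intPoint '' survivors S = intPoint '' survivors S := ht
  have ht1 := Set.vadd_mem_vadd_set (a := t) h0
  rw [ht'] at ht1
  obtain ⟨s, -, hs⟩ := ht1
  obtain rfl : intPoint s = t := by
    rw [hs, vadd_eq_add, show intPoint (0 : Fin n → ℤ) = 0 by ext i; simp, add_zero]
  have : s = 0 := by
    refine eq_zero_of_survivors_add hS fun x => ?_
    rw [← intPoint_injective.mem_set_image, ← intPoint_injective.mem_set_image (s := survivors S),
      ← Set.vadd_mem_vadd_set_iff (a := intPoint s) (x := intPoint x), ht', vadd_eq_add,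
      ← intPoint_add, add_comm]
  subst this
  ext i; simp

lemma isRepetitive_survivors (hS : IsDirectionPair S z) :
    IsRepetitive (intPoint '' survivors S) := by
  refine ⟨isDelone_survivors hS, fun T hT => ?_⟩
  obtain ⟨N, hN⟩ := exists_nat_ge T
  set j := 6 * N + 2
  refine ⟨n * (2 * scale (j + 1) + 1) + 1, by positivity, ?_⟩
  rintro c _ ⟨x, hx, rfl⟩
  obtain ⟨u, hu⟩ := exists_intPoint_near c
  obtain ⟨y, hy1, hy2⟩ := exists_patch_eq_near hS (lt_scale j) x u
  refine ⟨intPoint y, ⟨⟨y, ?_, rfl⟩, ?_⟩, ?_⟩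
  · simpa using (hy2 0 (by simp)).1 (by simpa using hx)
  · rw [Metric.mem_closedBall, dist_eq_norm]
    refine (norm_le_of_abs_coord_le (C := 2 * scale (j + 1) + 1) (by positivity)
      fun i => ?_).trans (by linarith)
    have h1 : |(y i : ℝ) - u i| ≤ 2 * scale (j + 1) := by exact_mod_cast hy1 i
    calc |(intPoint y - c) i| = |((y i : ℝ) - u i) + (u i - c i)| := by simp
      _ ≤ |(y i : ℝ) - u i| + |u i - c i| := abs_add_le _ _
      _ ≤ 2 * scale (j + 1) + 1 := add_le_add h1 (hu i)
  · rw [centeredPatch_intPoint, centeredPatch_intPoint]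
    congr 1
    ext v
    refine and_congr_left fun hv => (hy2 v fun i => ?_).symm
    exact abs_le_of_norm_intPoint_le (hv.trans hN) i

/-! ### Few patches at radii just below a scale -/

lemma encard_image_le_of_factors {α β γ : Type*} {f : α → β} {g : α → γ} {s : Set α} {t : Set β}
    (hf : ∀ x ∈ s, f x ∈ t) (h : ∀ x ∈ s, ∀ y ∈ s, f x = f y → g x = g y) :
    (g '' s).encard ≤ t.encard := by
  rcases s.eq_empty_or_nonempty with rfl | ⟨a, -⟩
  · simp
  have : Nonempty α := ⟨a⟩
  have hinv : ∀ c ∈ g '' s, Function.invFunOn g s c ∈ s := fun _ => Function.invFunOn_mem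
  have heq : ∀ c ∈ g '' s, g (Function.invFunOn g s c) = c := fun _ => Function.invFunOn_eq
  refine Set.encard_le_encard_of_injOn (f := fun c => f (Function.invFunOn g s c))
    (fun c hc => hf _ (hinv c hc)) fun c hc d hd hcd => ?_
  rw [← heq c hc, ← heq d hd]
  exact h _ (hinv c hc) _ (hinv d hd) hcd

/-- The vectors of length at most `N` from `x` to points on flats of the `j`-th system that
survive although a point of level exactly `j` would not, or the other way round. -/
def exceptionalPatch (S : Bool → Finset (Fin n)) (j N : ℕ) (x : Fin n → ℤ) : Set (Fin n → ℤ) :=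
  {v | ‖intPoint v‖ ≤ N ∧ (∃ σ, OnFlat S j σ (x + v)) ∧ (x + v ∈ survivors S ↔ ¬ Odd j)}

/-- The integer points at distance at most `N` from the origin of the flat through `u` with free
coordinates `S σ`. -/
def flatPatch (S : Bool → Finset (Fin n)) (N : ℕ) (σ : Bool) (u : Fin n → ℤ) :
    Set (Fin n → ℤ) :=
  {v | ‖intPoint v‖ ≤ N ∧ ∀ i, i ∉ S σ → v i = u i}

/-- The vectors of sup norm at most `N` that vanish in the coordinates `S σ`. -/
noncomputable def flatOffsets (S : Bool → Finset (Fin n)) (N : ℕ) (σ : Bool) : Finset (Fin n → ℤ) :=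
  Fintype.piFinset fun i => if i ∈ S σ then {0} else Finset.Icc (-N : ℤ) N

lemma card_flatOffsets (N : ℕ) (σ : Bool) :
    (flatOffsets S N σ).card = (2 * N + 1) ^ (n - (S σ).card) := by
  have h : ∀ i, (if i ∈ S σ then ({0} : Finset ℤ) else Finset.Icc (-N : ℤ) N).card =
      if i ∈ S σ then 1 else 2 * N + 1 := by
    intro i
    split_ifs
    · simp
    · rw [Int.card_Icc]; omega
  rw [flatOffsets, Fintype.card_piFinset]
  simp only [h]
  rw [Finset.prod_ite, Finset.prod_const_one, one_mul, Finset.prod_const]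
  congr 1
  rw [Finset.filter_not, Finset.card_sdiff]
  simp

/-- A patch is determined by its centre modulo `scale j` and by the exceptional vectors: off the
flats of the `j`-th system the residue decides, and on them a point is surviving according to the
parity of `j` unless it is exceptional. -/
lemma survivorPatch_eq_of_exceptionalPatch_eq {j N : ℕ} {x y : Fin n → ℤ}
    (hxy : ∀ i, (scale j : ℤ) ∣ x i - y i)
    (h : exceptionalPatch S j N x = exceptionalPatch S j N y) :
    survivorPatch S N x = survivorPatch S N y := by
  ext v
  refine and_congr_left fun hv => ?_
  have hmod : ∀ i, (scale j : ℤ) ∣ (x + v) i - (y + v) i := fun i => by simpa using hxy i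
  by_cases hflat : ∃ σ, OnFlat S j σ (x + v)
  · have hflat' : ∃ σ, OnFlat S j σ (y + v) :=
      hflat.imp fun σ hσ => (onFlat_congr_mod hmod le_rfl).1 hσ
    have := Set.ext_iff.1 h v
    simp only [exceptionalPatch, mem_ofPred_eq, hv, hflat, hflat', true_and] at this
    tauto
  · push Not at hflat
    exact mem_survivors_congr_mod hmod hflat

/-- At radii well below `scale (j + 1)`, the exceptional vectors come from a single flat of the
system `j + 1`. -/
lemma exceptionalPatch_eq_empty_or (hS : IsDirectionPair S z) {j N : ℕ}
    (hN : 6 * N + 2 < scale (j + 1)) (x : Fin n → ℤ) :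
    exceptionalPatch S j N x = ∅ ∨
      ∃ σ, ∃ u ∈ flatOffsets S N σ, exceptionalPatch S j N x = flatPatch S N σ u := by
  have hnext : ∀ v ∈ exceptionalPatch S j N x, ∃ σ, OnFlat S (j + 1) σ (x + v) := by
    rintro v ⟨-, ⟨σ, hσ⟩, hv⟩
    refine ⟨σ, ?_⟩
    by_contra hc
    rw [mem_survivors_iff_odd hS hσ hc] at hv
    tauto
  rcases (exceptionalPatch S j N x).eq_empty_or_nonempty with h | ⟨v₀, hv₀⟩
  · exact Or.inl h
  obtain ⟨σ, hσ⟩ := hnext v₀ hv₀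
  have habs : ∀ v : Fin n → ℤ, ‖intPoint v‖ ≤ N → ∀ i, |v i| ≤ N :=
    fun v hv => abs_le_of_norm_intPoint_le hv
  refine Or.inr ⟨σ, fun i => if i ∈ S σ then 0 else v₀ i, ?_, ?_⟩
  · refine Fintype.mem_piFinset.2 fun i => ?_
    split_ifs
    · simp
    · exact Finset.mem_Icc.2 (abs_le.1 (habs v₀ hv₀.1 i))
  · ext v
    constructor
    · intro hv
      obtain ⟨τ, hτ⟩ := hnext v hv
      obtain ⟨-, hoff⟩ := hσ.eq_of_close hS hτ fun i _ _ => by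
        have h1 := abs_le.1 (habs v₀ hv₀.1 i)
        have h2 := abs_le.1 (habs v hv.1 i)
        have : |(x + v₀) i - (x + v) i| ≤ 2 * N := by
          simp only [Pi.add_apply]
          rw [abs_le]; constructor <;> linarith
        omega
      refine ⟨hv.1, fun i hi => ?_⟩
      have := hoff i hi
      simp only [Pi.add_apply] at this
      simp only [hi, if_false]
      omega
    · rintro ⟨hv1, hv2⟩
      have hoff : ∀ i, i ∉ S σ → (x + v₀) i = (x + v) i := fun i hi => by
        have := hv2 i hi
        simp only [hi, if_false] at this
        simp [this]
      refine ⟨hv1, ⟨σ, ?_⟩, ?_⟩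
      · exact ((onFlat_congr_off hoff).1 hσ).anti (Nat.le_succ j)
      · rw [← mem_survivors_congr_off hS hσ hoff]
        exact hv₀.2.2

/-- Patches are counted by residues modulo `scale j` and possible exceptional sets. -/
lemma patchCount_le (hS : IsDirectionPair S z) {k : ℕ} (hk : ∀ σ, (S σ).card = k) {j N : ℕ}
    (hN : 6 * N + 2 < scale (j + 1)) :
    patchCount (intPoint '' survivors S) N ≤
      ((scale j ^ n * (2 * (2 * N + 1) ^ (n - k) + 1) : ℕ) : ℝ≥0∞) := by
  classical
  have : NeZero (scale j) := ⟨(scale_pos j).ne'⟩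
  let E : Finset (Set (Fin n → ℤ)) :=
    insert ∅ (Finset.univ.biUnion fun σ => (flatOffsets S N σ).image (flatPatch S N σ))
  have hE : E.card ≤ 2 * (2 * N + 1) ^ (n - k) + 1 := by
    refine (Finset.card_insert_le _ _).trans (Nat.add_le_add_right ?_ 1)
    refine (Finset.card_biUnion_le_card_mul _ _ _ fun σ _ => Finset.card_image_le.trans
      ((card_flatOffsets N σ).trans_le (by rw [hk]))).trans ?_
    simp
  let D : Finset ((Fin n → ZMod (scale j)) × Set (Fin n → ℤ)) := Finset.univ ×ˢ E
  have hD : D.card ≤ scale j ^ n * (2 * (2 * N + 1) ^ (n - k) + 1) := by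
    rw [Finset.card_product]
    refine Nat.mul_le_mul (le_of_eq ?_) hE
    simp [ZMod.card]
  have h : (survivorPatch S N '' survivors S).encard ≤ (D : Set ((Fin n → ZMod (scale j)) × Set (Fin n → ℤ))).encard := by
    refine encard_image_le_of_factors
      (f := fun x => (fun i => (x i : ZMod (scale j)), exceptionalPatch S j N x))
      (fun x _ => ?_) fun x _ y _ hxy => ?_
    · refine Finset.mem_coe.2 (Finset.mem_product.2 ⟨Finset.mem_univ _, ?_⟩)
      rcases exceptionalPatch_eq_empty_or hS hN x with h | ⟨σ, u, hu, h⟩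
      · exact Finset.mem_insert.2 (Or.inl h)
      · refine Finset.mem_insert_of_mem (Finset.mem_biUnion.2 ⟨σ, Finset.mem_univ _, ?_⟩)
        exact Finset.mem_image.2 ⟨u, hu, h.symm⟩
    · obtain ⟨h1, h2⟩ := Prod.mk.inj hxy
      refine survivorPatch_eq_of_exceptionalPatch_eq (fun i => ?_) h2
      rw [← dvd_neg, neg_sub]
      exact (ZMod.intCast_eq_intCast_iff_dvd_sub _ _ _).1 (congrFun h1 i)
  rw [patchCount_intPoint]
  rw [Set.encard_coe_eq_coe_finsetCard] at h
  calc ((survivorPatch S N '' survivors S).encard : ℝ≥0∞) ≤ ((D.card : ℕ∞) : ℝ≥0∞) := by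
        exact_mod_cast h
    _ = (D.card : ℝ≥0∞) := by simp
    _ ≤ _ := by exact_mod_cast hD

/-- The lower limit is attained along the radii `scale j ^ (j + 2)`, whose `ε`-th power eventually
exceeds `scale j ^ (n + 1)`. -/
lemma liminf_patchCount_eq_zero (hS : IsDirectionPair S z) {k : ℕ} (hk : ∀ σ, (S σ).card = k)
    {ε : ℝ} (hε : 0 < ε) :
    liminf (fun T : ℝ => patchCount (intPoint '' survivors S) T /
      ENNReal.ofReal (T ^ (((n - k : ℕ) : ℝ) + ε))) atTop = 0 := by
  set u := fun T : ℝ => patchCount (intPoint '' survivors S) T /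
      ENNReal.ofReal (T ^ (((n - k : ℕ) : ℝ) + ε)) with hu
  let T : ℕ → ℝ := fun j => ((scale j ^ (j + 2) : ℕ) : ℝ)
  have hscale : Tendsto (fun j => (scale j : ℝ)) atTop atTop :=
    tendsto_natCast_atTop_atTop.comp (tendsto_atTop_mono (fun j => (lt_scale j).le) tendsto_id)
  have hT : Tendsto T atTop atTop := by
    refine tendsto_atTop_mono (fun j => ?_) hscale
    exact Nat.cast_le.2 (Nat.le_self_pow (by omega) (scale j))
  have hbound : ∀ᶠ j in atTop, u (T j) ≤ ENNReal.ofReal (3 ^ (n + 1) * (scale j : ℝ)⁻¹) := by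
    have hlarge : ∀ᶠ j : ℕ in atTop, (n + 1 : ℝ) ≤ (j + 2 : ℕ) * ε := by
      obtain ⟨m, hm⟩ := exists_nat_ge ((n + 1 : ℝ) / ε)
      filter_upwards [eventually_ge_atTop m] with j hj
      rw [← div_le_iff₀ hε]
      refine hm.trans ?_
      exact_mod_cast (by omega : m ≤ j + 2)
    filter_upwards [hlarge, eventually_ge_atTop 8] with j hj hj8
    set q := scale j with hq
    have hq8 : 8 < q := lt_of_le_of_lt hj8 (lt_scale j)
    have hq0 : (0 : ℝ) < q := by positivity
    set N := q ^ (j + 2) with hNdef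
    have hN1 : 1 ≤ N := Nat.one_le_pow _ _ (by omega)
    have hN : 6 * N + 2 < scale (j + 1) := by
      rw [scale_succ, pow_succ, ← hq, ← hNdef]
      nlinarith
    have hTN : T j = (N : ℝ) := rfl
    have hcount : patchCount (intPoint '' survivors S) (T j) ≤
        ENNReal.ofReal (3 ^ (n + 1) * (q : ℝ) ^ n * (N : ℝ) ^ (n - k)) := by
      rw [hTN]
      refine (patchCount_le hS hk hN).trans ?_
      rw [← ENNReal.ofReal_natCast]
      refine ENNReal.ofReal_le_ofReal ?_
      have h1 : 2 * (2 * N + 1) ^ (n - k) + 1 ≤ 3 ^ (n + 1) * N ^ (n - k) := by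
        have h2 : (2 * N + 1) ^ (n - k) ≤ 3 ^ n * N ^ (n - k) :=
          calc (2 * N + 1) ^ (n - k) ≤ (3 * N) ^ (n - k) := Nat.pow_le_pow_left (by omega) _
            _ = 3 ^ (n - k) * N ^ (n - k) := mul_pow _ _ _
            _ ≤ 3 ^ n * N ^ (n - k) := by gcongr <;> omega
        have h3 : 1 ≤ 3 ^ n * N ^ (n - k) := Nat.one_le_iff_ne_zero.2 (by positivity)
        rw [pow_succ]
        linarith
      have h4 := Nat.mul_le_mul_left (q ^ n) h1
      rw [show 3 ^ (n + 1) * (q : ℝ) ^ n * (N : ℝ) ^ (n - k) =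
        ((q ^ n * (3 ^ (n + 1) * N ^ (n - k)) : ℕ) : ℝ) by push_cast; ring]
      exact_mod_cast h4
    have hN0 : (0 : ℝ) < N := by exact_mod_cast hN1
    have hpow : (N : ℝ) ^ (n - k) * (q : ℝ) ^ (n + 1) ≤ (N : ℝ) ^ (((n - k : ℕ) : ℝ) + ε) := by
      rw [Real.rpow_add hN0, Real.rpow_natCast]
      gcongr
      rw [hNdef, Nat.cast_pow, ← Real.rpow_natCast, ← Real.rpow_natCast, ← Real.rpow_mul hq0.le]
      refine Real.rpow_le_rpow_of_exponent_le (by exact_mod_cast (by omega : 1 ≤ q)) ?_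
      push_cast at hj ⊢
      exact hj
    have hpos : 0 < (N : ℝ) ^ (((n - k : ℕ) : ℝ) + ε) := by positivity
    calc u (T j) ≤ ENNReal.ofReal (3 ^ (n + 1) * (q : ℝ) ^ n * (N : ℝ) ^ (n - k)) /
          ENNReal.ofReal ((N : ℝ) ^ (((n - k : ℕ) : ℝ) + ε)) := ENNReal.div_le_div_right hcount _
      _ = ENNReal.ofReal (3 ^ (n + 1) * (q : ℝ) ^ n * (N : ℝ) ^ (n - k) /
          (N : ℝ) ^ (((n - k : ℕ) : ℝ) + ε)) := (ENNReal.ofReal_div_of_pos hpos).symm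
      _ ≤ ENNReal.ofReal (3 ^ (n + 1) * (q : ℝ)⁻¹) := by
        refine ENNReal.ofReal_le_ofReal ?_
        rw [div_le_iff₀ hpos]
        calc 3 ^ (n + 1) * (q : ℝ) ^ n * (N : ℝ) ^ (n - k)
            = 3 ^ (n + 1) * (q : ℝ)⁻¹ * ((N : ℝ) ^ (n - k) * (q : ℝ) ^ (n + 1)) := by
              rw [pow_succ (q : ℝ)]; field_simp
          _ ≤ _ := by gcongr
  have hlim : Tendsto (u ∘ T) atTop (nhds 0) := by
    refine tendsto_of_tendsto_of_tendsto_of_le_of_le' tendsto_const_nhds ?_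
      (Eventually.of_forall fun _ => zero_le) hbound
    rw [← ENNReal.ofReal_zero, ← mul_zero ((3 : ℝ) ^ (n + 1))]
    exact ENNReal.tendsto_ofReal (tendsto_const_nhds.mul (tendsto_inv_atTop_zero.comp hscale))
  refine le_antisymm ?_ zero_le
  calc liminf u atTop ≤ liminf u (map T atTop) := liminf_le_liminf_of_le hT
    _ = 0 := hlim.liminf_eq

/-! ### Many patches at radii just above a scale -/

/-- All points of `4ℤⁿ` survive, and those that are incongruent modulo `scale j` have different
patches. -/
lemma scale_div_four_pow_le_patchCount (hS : IsDirectionPair S z) {j : ℕ} {T : ℝ}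
    (hT : n * (2 * scale j) ≤ T) :
    ((scale j / 4 : ℕ) : ℝ≥0∞) ^ n ≤ patchCount (intPoint '' survivors S) T := by
  let g : (Fin n → Fin (scale j / 4)) → Fin n → ℤ := fun m i => 4 * (m i : ℤ)
  have hg : ∀ m, g m ∈ survivors S := fun m =>
    mem_survivors_of_scale_zero_dvd hS fun i => dvd_mul_right _ _
  have hinj : Function.Injective fun m => survivorPatch S T (g m) := by
    intro a b hab
    have h := modEq_of_survivorPatch_eq hS hT
      (fun i => dvd_sub (dvd_mul_right _ _) (dvd_mul_right _ _)) hab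
    ext i
    have h1 := (a i).2
    have h2 := (b i).2
    have h3 : g a i - g b i = 0 := by
      refine Int.eq_zero_of_abs_lt_dvd (h i) ?_
      rw [abs_lt]
      simp only [g]
      omega
    simp only [g] at h3
    omega
  have h : (Set.univ : Set (Fin n → Fin (scale j / 4))).encard ≤
      (survivorPatch S T '' survivors S).encard :=
    Set.encard_le_encard_of_injOn (fun m _ => ⟨g m, hg m, rfl⟩) hinj.injOn
  rw [patchCount_intPoint]
  have hcard : (Set.univ : Set (Fin n → Fin (scale j / 4))).encard =
      (((scale j / 4) ^ n : ℕ) : ℕ∞) := by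
    simp [Set.encard_univ]
  rw [hcard] at h
  calc ((scale j / 4 : ℕ) : ℝ≥0∞) ^ n = ((((scale j / 4) ^ n : ℕ) : ℕ∞) : ℝ≥0∞) := by simp
    _ ≤ _ := by exact_mod_cast h

lemma limsup_patchCount_pos (hS : IsDirectionPair S z) :
    0 < limsup (fun T : ℝ =>
      patchCount (intPoint '' survivors S) T / ENNReal.ofReal (T ^ n)) atTop := by
  have hn : 0 < n := z.pos
  have hn' : (0 : ℝ) < n := by exact_mod_cast hn
  have hc : 0 < ENNReal.ofReal ((1 / (8 * n) : ℝ) ^ n) := ENNReal.ofReal_pos.2 (by positivity)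
  refine hc.trans_le (le_limsup_of_frequently_le' (frequently_atTop.2 fun a => ?_))
  obtain ⟨j, hj⟩ := exists_nat_ge a
  have hq : (0 : ℝ) < scale j := by exact_mod_cast scale_pos j
  have hjq : (j : ℝ) ≤ scale j := by exact_mod_cast (lt_scale j).le
  have hn1 : (1 : ℝ) ≤ n := by exact_mod_cast hn
  refine ⟨n * (2 * scale j), by nlinarith, ?_⟩
  have hpos : 0 < ((n : ℝ) * (2 * scale j)) ^ n := by positivity
  rw [ENNReal.le_div_iff_mul_le (Or.inl (ENNReal.ofReal_pos.2 hpos).ne')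
    (Or.inl ENNReal.ofReal_ne_top)]
  refine le_trans (le_of_eq ?_) (scale_div_four_pow_le_patchCount hS le_rfl)
  obtain ⟨t, ht⟩ : 4 ∣ scale j := scale_zero ▸ scale_dvd_scale j.zero_le
  rw [ht, Nat.mul_div_cancel_left _ (by norm_num), ← ENNReal.ofReal_mul (by positivity),
    ← mul_pow, ENNReal.ofReal_pow (by positivity), ← ENNReal.ofReal_natCast]
  congr 2
  push_cast
  field_simp
  norm_num

/-! ### The hierarchy of flats -/

/-- The flat through the integer point `p` with free coordinates `s`. -/
def coordFlat (s : Finset (Fin n)) (p : Fin n → ℤ) : Set (EuclideanSpace ℝ (Fin n)) :=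
  {x | ∀ i, i ∉ s → x i = (p i : ℝ)}

/-- The `j`-th system of flats, with the two families of directions `S true` and `S false`. -/
def flatSystem (S : Bool → Finset (Fin n)) (j : ℕ) : Set (Set (EuclideanSpace ℝ (Fin n))) :=
  {L | ∃ σ p, OnFlat S j σ p ∧ L = coordFlat (S σ) p}

lemma intPoint_mem_coordFlat {s : Finset (Fin n)} {p x : Fin n → ℤ} :
    intPoint x ∈ coordFlat s p ↔ ∀ i, i ∉ s → x i = p i := by
  simp [coordFlat]

lemma coordFlat_congr {s : Finset (Fin n)} {p x : Fin n → ℤ} (h : ∀ i, i ∉ s → x i = p i) :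
    coordFlat s x = coordFlat s p := by
  ext v
  exact forall₂_congr fun i hi => by rw [h i hi]

/-- Two flats of different directions that lie in some systems are disjoint, so the direction of a
flat can be recovered from the underlying set. -/
lemma coordFlat_mem_flatSystem_iff (hS : IsDirectionPair S z) {i j : ℕ} {σ : Bool}
    {x : Fin n → ℤ} (hx : OnFlat S i σ x) :
    coordFlat (S σ) x ∈ flatSystem S j ↔ OnFlat S j σ x := by
  refine ⟨?_, fun h => ⟨σ, x, h, rfl⟩⟩
  rintro ⟨τ, p, hp, h⟩
  have h1 : intPoint x ∈ coordFlat (S τ) p := h ▸ intPoint_mem_coordFlat.2 fun _ _ => rfl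
  have h2 := (onFlat_congr_off (intPoint_mem_coordFlat.1 h1)).2 hp
  obtain rfl := hx.dir_unique hS h2
  exact h2

/-- Distinct flats of one system are far apart. -/
lemma flatSystem_eq_of_close (hS : IsDirectionPair S z) {j : ℕ} {D : ℝ}
    (hD : 3 * D + 2 ≤ scale j) {L L' : Set (EuclideanSpace ℝ (Fin n))} (hL : L ∈ flatSystem S j)
    (hL' : L' ∈ flatSystem S j) {x y : EuclideanSpace ℝ (Fin n)} (hx : x ∈ L) (hy : y ∈ L')
    (hxy : dist x y < D) : L = L' := by
  obtain ⟨σ, p, hp, rfl⟩ := hL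
  obtain ⟨τ, p', hp', rfl⟩ := hL'
  obtain ⟨rfl, h⟩ := hp.eq_of_close hS hp' fun i h1 h2 => by
    have h3 := abs_coord_le_norm (x - y) i
    rw [← dist_eq_norm, PiLp.sub_apply, hx i h1, hy i h2] at h3
    have h4 : (3 : ℝ) * |(p i : ℝ) - p' i| + 2 < scale j := by linarith
    exact_mod_cast h4
  exact coordFlat_congr h

lemma isFlatHierarchy_flatSystem (hS : IsDirectionPair S z) {k : ℕ} (hk : ∀ σ, (S σ).card = k) :
    IsFlatHierarchy k (flatSystem S) where
  flat := by
    rintro _ ⟨σ, p, -, rfl⟩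
    exact ⟨S σ, hk σ, p, rfl⟩
  disjoint L hL L' hL' hne := by
    refine Set.disjoint_left.2 fun x hx hx' => hne ?_
    refine flatSystem_eq_of_close hS (D := 1 / 2) ?_ hL hL' hx hx' (by simp)
    rw [scale_zero]; norm_num
  nested j := by
    rintro _ ⟨σ, p, hp, rfl⟩
    exact ⟨σ, p, hp.anti j.le_succ, rfl⟩
  vanishing L := by
    by_cases h : L ∈ flatSystem S 0
    · obtain ⟨σ, p, hp, rfl⟩ := h
      obtain ⟨j, hj⟩ := exists_not_onFlat hS σ p
      exact ⟨j, fun h => hj ((coordFlat_mem_flatSystem_iff hS hp).1 h)⟩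
    · exact ⟨0, h⟩
  periodic j := by
    refine ⟨scale j, scale_pos j, ?_⟩
    rintro v hv _ ⟨σ, p, hp, rfl⟩
    obtain ⟨w, rfl⟩ := mem_integerPoints_iff.1 hv
    refine ⟨σ, fun i => p i + scale j * w i, fun i hi => ?_, ?_⟩
    · have : 3 * (p i + scale j * w i) + dirSign σ =
          3 * p i + dirSign σ + scale j * (3 * w i) := by ring
      rw [this]
      exact dvd_add (hp i hi) (dvd_mul_right _ _)
    · ext x
      rw [Set.mem_vadd_set_iff_neg_vadd_mem]
      refine forall₂_congr fun i _ => ?_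
      rw [vadd_eq_add, PiLp.add_apply, PiLp.neg_apply, PiLp.smul_apply, intPoint_apply,
        smul_eq_mul, neg_add_eq_iff_eq_add, add_comm]
      push_cast
      rfl
  separated D := by
    obtain ⟨j, hj⟩ := exists_nat_ge (3 * D + 2)
    have hjq : (j : ℝ) ≤ scale j := by exact_mod_cast (lt_scale j).le
    refine ⟨j, fun L hL L' hL' hne x hx y hy => ?_⟩
    by_contra! hlt
    exact hne (flatSystem_eq_of_close hS (hj.trans hjq) hL hL' hx hy hlt)

lemma image_survivors_eq_hierarchicalRemoval (hS : IsDirectionPair S z) :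
    intPoint '' survivors S = hierarchicalRemoval (flatSystem S) := by
  ext v
  constructor
  · rintro ⟨x, hx, rfl⟩
    refine ⟨mem_integerPoints_iff.2 ⟨x, rfl⟩, ?_⟩
    rintro j _ ⟨⟨σ, p, hp, rfl⟩, hL⟩ hxL
    have h := intPoint_mem_coordFlat.1 hxL
    refine hL ⟨σ, p, ?_, rfl⟩
    exact (onFlat_congr_off h).1 (hx j σ ((onFlat_congr_off h).2 hp))
  · rintro ⟨hv, h⟩
    obtain ⟨x, rfl⟩ := mem_integerPoints_iff.1 hv
    refine ⟨x, fun j σ hx => ?_, rfl⟩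
    by_contra hc
    exact h j (coordFlat (S σ) x) ⟨⟨σ, x, hx, rfl⟩,
      fun hm => hc ((coordFlat_mem_flatSystem_iff hS hx).1 hm)⟩
      (intPoint_mem_coordFlat.2 fun _ _ => rfl)

lemma exists_isDirectionPair {n : ℕ} (hn : 0 < n) :
    ∃ (S : Bool → Finset (Fin n)) (z : Fin n), IsDirectionPair S z ∧
      ∀ σ, (S σ).card = (n - 1) / 2 := by
  let z : Fin n := ⟨0, hn⟩
  obtain ⟨A, hA, hAk⟩ := Finset.exists_subset_card_eq
    (s := Finset.univ.erase z) (n := (n - 1) / 2) (by simp; omega)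
  obtain ⟨B, hB, hBk⟩ := Finset.exists_subset_card_eq
    (s := Finset.univ.erase z \ A) (n := (n - 1) / 2) (by
      rw [Finset.card_sdiff_of_subset hA]; simp; omega)
  refine ⟨fun σ => if σ then A else B, z, ⟨?_, fun i => ?_⟩, ?_⟩
  · rintro (_ | _) hz
    · simpa using hB hz
    · simpa using hA hz
  · by_cases hi : i ∈ A
    · exact ⟨false, fun h => (Finset.mem_sdiff.1 (hB h)).2 hi⟩
    · exact ⟨true, hi⟩
  · rintro (_ | _)
    · exact hBk
    · exact hAk

/-- The exponent of the lower limit is the codimension `n - k` of the flats. -/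
lemma ceil_half_eq {n : ℕ} (hn : 0 < n) :
    ⌈((n : ℝ) + 1) / 2⌉ = ((n - (n - 1) / 2 : ℕ) : ℤ) := by
  rw [Int.ceil_eq_iff]
  set m := n - (n - 1) / 2 with hm
  have h1 : 2 * m ≤ n + 2 := by omega
  have h2 : n + 1 ≤ 2 * m := by omega
  have h1' : (2 : ℝ) * m ≤ n + 2 := by exact_mod_cast h1
  have h2' : (n : ℝ) + 1 ≤ 2 * m := by exact_mod_cast h2
  push_cast
  constructor <;> linarith

theorem theorem2p2 (n : ℕ) (hn : 3 ≤ n) :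
    ∃ X : Set (EuclideanSpace ℝ (Fin n)),
      IsAperiodic X ∧ IsRepetitive X ∧ IsMeyer X ∧
      (∀ ε : ℝ, 0 < ε →
        liminf (fun T : ℝ =>
          patchCount X T / ENNReal.ofReal (T ^ ((⌈((n : ℝ) + 1) / 2⌉ : ℝ) + ε))) atTop = 0) ∧
      0 < limsup (fun T : ℝ => patchCount X T / ENNReal.ofReal (T ^ n)) atTop ∧
      ∃ F : ℕ → Set (Set (EuclideanSpace ℝ (Fin n))),
        IsFlatHierarchy ((n - 1) / 2) F ∧ X = hierarchicalRemoval F := by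
  obtain ⟨S, z, hS, hk⟩ := exists_isDirectionPair (n := n) (by omega)
  refine ⟨intPoint '' survivors S, isAperiodic_survivors hS, isRepetitive_survivors hS,
    isMeyer_survivors hS, fun ε hε => ?_, limsup_patchCount_pos hS, flatSystem S,
    isFlatHierarchy_flatSystem hS hk, image_survivors_eq_hierarchicalRemoval hS⟩
  rw [ceil_half_eq (by omega), Int.cast_natCast]
  exact liminf_patchCount_eq_zero hS hk hε
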